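/- Let $Y$ be a nonempty totally ordered set and $d\ge 0$. A nested convex family in $\mathbb R^d$ is a map $\kappa$ from $Y$ to the compact convex subsets of $\mathbb R^d$ (the empty set allowed) such that $\kappa(\lambda_1)\subseteq\kappa(\lambda_2)$ whenever $\lambda_1<\lambda_2$, and $\kappa(\lambda)=\bigcap_{\lambda'>\lambda}\kappa(\lambda')$ for every $\lambda\in Y$ that is not the greatest element of $Y$ and satisfies $\lambda=\inf\{\lambda'\mid\lambda'>\lambda\}$. It is constant if $\kappa(\lambda)$ does not depend on $\lambda$. It is continuously shrinking if $\kappa(\lambda')$ is contained in the interior of $\kappa(\lambda)$ for all $\lambda'<\lambda$, and there is no nonempty open set $U\subseteq\mathbb R^d$ on which the function $q_\kappa(x)=\min\{\lambda\in Y\mid x\in\kappa(\lambda)\}$ is everywhere defined and constant. A quasiconvex program is given by finitely many nested convex families $\kappa_i$, $i\in S$. For $T\subseteq S$, a pair $(\lambda,x)$ with $\lambda\in Y$ and $x\in\mathbb R^d$ is feasible for $T$ if $x\in\kappa_i(\lambda)$ for all $i\in T$; if $Y$ has no least element, a level $-\infty$ is adjoined below $Y$, with $\kappa_i(-\infty)=\bigcap_{\lambda\in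 Y}\kappa_i(\lambda)$. The value $\Lambda(T)$ is the least feasible pair for $T$ in the lexicographic order, first by $\lambda$ and then by the coordinates of $x$. By convention $\Lambda(T)$ is a symbol larger than all pairs if no pair is feasible, and a symbol smaller than all pairs if there are feasible pairs but no least one. Assume that for every nonempty $T\subseteq S$ the set $\{\lambda\in Y\mid\bigcap_{i\in T}\kappa_i(\lambda)\ne\emptyset\}$, if it is nonempty and bounded below in $Y$, has an infimum in $Y$ (this is automatic if, as in $\mathbb R$, $\mathbb Z$ or $[-\infty,\infty]$, every nonempty subset of $Y$ that is bounded below has an infimum). Then: (1) for every nonempty $T\subseteq S$ for which some pair is feasible, a least feasible pair exists, and $\Lambda(T)$ is this pair; (2) $\Lambda$ is the objective function of an LP-type problem: $\Lambda(A)\le\Lambda(B)$ for all $A\subseteq B\subseteq S$, and whenever $A\subseteq S$ and $p,q\in S$ satisfy $\Lambda(A)=\Lambda(A\cup\{p\})=\Lambda(A\cup\{q\})$, also $\Lambda(A)=\Lambda(A\cup\{p,q\})$; (3) every basis, that is, every $B\subseteq S$ with $\Lambda(A)<\Lambda(B)$ for all $A\subsetneq B$, has at most $2d+1$ elements; (4)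 if each $\kappa_i$ is constant or continuously shrinking, every basis has at most $d+1$ elements. -/

import Mathlib

open Set

/-- A nested convex family in `ℝ^d` with levels in the totally ordered set `Y`: a map from `Y` to
the compact convex subsets (possibly empty) of `ℝ^d` that is monotone and continuous from above.
The condition `(Ioi l).Nonempty` says that `l` is not the greatest element of `Y`
(there is no continuity requirement at a greatest element). -/
structure NestedConvexFamily (Y : Type*) [LinearOrder Y] (d : ℕ) where
  /-- The sets of the family. -/
  toFun : Y → Set (Fin d → ℝ)
  isCompact' : ∀ l, IsCompact (toFun l)
  convex' : ∀ l, Convex ℝ (toFun l)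
  mono' : ∀ l₁ l₂, l₁ < l₂ → toFun l₁ ⊆ toFun l₂
  inter' : ∀ l, (Ioi l).Nonempty → IsGLB (Ioi l) l → toFun l = ⋂ l' ∈ Ioi l, toFun l'

namespace NestedConvexFamily

variable {Y : Type*} [LinearOrder Y] {d : ℕ}

/-- The family does not depend on the level. -/
def IsConstant (κ : NestedConvexFamily Y d) : Prop :=
  ∀ l₁ l₂, κ.toFun l₁ = κ.toFun l₂

/-- `κ.HasLevel x c` says that the quasiconvex function
`q_κ(x) = inf {l | x ∈ κ(l)} = min {l | x ∈ κ(l)}` of the family is defined at `x` and has the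
value `c` there. -/
def HasLevel (κ : NestedConvexFamily Y d) (x : Fin d → ℝ) (c : Y) : Prop :=
  IsLeast {l | x ∈ κ.toFun l} c

/-- The family is continuously shrinking: its quasiconvex function is not constant on any nonempty
open set, and each of its sets lies in the interior of every later one. -/
def IsContinuouslyShrinking (κ : NestedConvexFamily Y d) : Prop :=
  (¬ ∃ (U : Set (Fin d → ℝ)) (c : Y), IsOpen U ∧ U.Nonempty ∧ ∀ x ∈ U, κ.HasLevel x c) ∧
    ∀ l' l, l' < l → κ.toFun l' ⊆ interior (κ.toFun l)

end NestedConvexFamily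

/-- `f`, defined on the subsets of the finite set `ι` of constraints, is the objective of an
LP-type problem. -/
structure IsLPType {ι V : Type*} [DecidableEq ι] [LinearOrder V] (f : Finset ι → V) : Prop where
  mono : ∀ A B : Finset ι, A ⊆ B → f A ≤ f B
  locality : ∀ (A : Finset ι) (p q : ι),
    f A = f (A ∪ {p}) → f A = f (A ∪ {q}) → f A = f (A ∪ {p, q})

/-- A basis: a set of constraints all of whose proper subsets have a smaller objective value. -/
def IsLPBasis {ι V : Type*} [LinearOrder V] (f : Finset ι → V) (B : Finset ι) : Prop :=
  ∀ A : Finset ι, A ⊂ B → f A < f B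

/-- Every basis has at most `k` elements. -/
def LPDimensionLE {ι V : Type*} [LinearOrder V] (f : Finset ι → V) (k : ℕ) : Prop :=
  ∀ B : Finset ι, IsLPBasis f B → B.card ≤ k

namespace QuasiconvexProgram

variable {Y : Type*} [LinearOrder Y] {d : ℕ} {ι : Type*}

/-- The levels `l ∈ Y` at which the sets of all the families in `T` have a common point. -/
def levels (κ : ι → NestedConvexFamily Y d) (T : Finset ι) : Set Y :=
  {l | ∃ x : Fin d → ℝ, ∀ i ∈ T, x ∈ (κ i).toFun l}

/-- Pairs of a level and a point, in the lexicographic order: first by the level, then by the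
coordinates of the point. The level is an element of `Y` or the adjoined least level `⊥`. -/
abbrev Pairs (Y : Type*) (d : ℕ) : Type _ := WithBot Y ×ₗ Lex (Fin d → ℝ)

/-- The feasible pairs of the program formed by the families in `T`: the pairs `(l, x)` with
`x ∈ κᵢ(l)` for all `i ∈ T`. If `Y` has no least element, there is also the level `⊥ = -∞`, with
`κᵢ(-∞) = ⋂ l, κᵢ(l)`; if `Y` has a least element, nothing is added. -/
def feasible (κ : ι → NestedConvexFamily Y d) (T : Finset ι) : Set (Pairs Y d) :=
  {p | (∃ (l : Y) (x : Fin d → ℝ), p = toLex ((l : WithBot Y), toLex x) ∧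
          ∀ i ∈ T, x ∈ (κ i).toFun l) ∨
       (NoMinOrder Y ∧ ∃ x : Fin d → ℝ, p = toLex ((⊥ : WithBot Y), toLex x) ∧
          ∀ i ∈ T, ∀ l : Y, x ∈ (κ i).toFun l)}

open Classical in
/-- The value of the program formed by the families in `T`: the lexicographically least feasible
pair. It is `⊤` if there is no feasible pair at all, and `⊥` if there are feasible pairs but no
least one (as for the empty program, when `d > 0`). -/
noncomputable def value (κ : ι → NestedConvexFamily Y d) (T : Finset ι) :
    WithBot (WithTop (Pairs Y d)) :=
  if h : ∃ p, IsLeast (feasible κ T) p then ((h.choose : WithTop (Pairs Y d)) : WithBot _)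
  else if (feasible κ T).Nonempty then ⊥
  else ((⊤ : WithTop (Pairs Y d)) : WithBot _)

end QuasiconvexProgram

/-! Existence of optima is compactness along a chain of levels, and locality holds because feasible
sets intersect. The dimension bounds are Helly-type arguments. If `B` is a basis with optimum `(a,
c)`, dropping `i` yields an optimum `(bᵢ, xᵢ) < (a, c)`, with `xᵢ` in every set but perhaps the
`i`-th. Split the points of any `d + 2` indices by Radon: each `j` is missing from one part, so the
Radon point lies in the `j`-th set, hence in all (`mem_of_mem_convexHull_image_inter_compl`). Points
with `bᵢ < a` share a level below `a`, so there are at most `d + 1` of them. Those with `bᵢ = a` and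
`xᵢ` lexicographically below `c` number at most `d`, since `c` itself serves as an additional point.
Together this gives `2d + 1`. For constant or continuously shrinking families both kinds go into one
Radon partition: points from lower levels push the Radon point into interiors, from which the level
can be lowered. -/

/-! ### Lexicographic order, Radon partitions and convex hulls -/

/-- With positive weights, the earlier of the two indices where `x` and `y` first drop below `c`
decides the comparison for the combination. -/
theorem convex_setOf_toLex_lt {d : ℕ} (c : Fin d → ℝ) :
    Convex ℝ {x : Fin d → ℝ | toLex x < toLex c} := by
  intro x hx y hy a b ha hb hab
  obtain ⟨i, hi, hxi⟩ := hx
  obtain ⟨j, hj, hyj⟩ := hy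
  simp only [Pi.toLex_apply] at hi hj hxi hyj
  have eq_of : ∀ k, x k = c k → y k = c k → a * x k + b * y k = c k := fun k h₁ h₂ => by
    rw [h₁, h₂, ← add_mul, hab, one_mul]
  have lt_of : ∀ k, x k ≤ c k → y k ≤ c k → x k < c k ∧ y k < c k ∨
      (x k < c k ∧ 0 < a) ∨ (y k < c k ∧ 0 < b) → a * x k + b * y k < c k := by
    intro k h₁ h₂ h
    have hck : c k = a * c k + b * c k := by rw [← add_mul, hab, one_mul]
    have h₃ := mul_le_mul_of_nonneg_left h₁ ha
    have h₄ := mul_le_mul_of_nonneg_left h₂ hb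
    rcases h with ⟨h₅, h₆⟩ | ⟨h₅, h₆⟩ | ⟨h₅, h₆⟩
    · rcases ha.eq_or_lt with h₀ | h₀
      · have hb₁ : 0 < b := by linarith
        linarith [mul_lt_mul_of_pos_left h₆ hb₁]
      · linarith [mul_lt_mul_of_pos_left h₅ h₀]
    · linarith [mul_lt_mul_of_pos_left h₅ h₆]
    · linarith [mul_lt_mul_of_pos_left h₅ h₆]
  rcases ha.eq_or_lt with rfl | ha₀
  · obtain rfl : b = 1 := by linarith
    simpa using ⟨j, hj, hyj⟩
  rcases hb.eq_or_lt with rfl | hb₀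
  · obtain rfl : a = 1 := by linarith
    simpa using ⟨i, hi, hxi⟩
  rcases lt_trichotomy i j with hij | rfl | hij
  · exact ⟨i, fun k hk => eq_of k (hi k hk) (hj k (hk.trans hij)),
      lt_of i hxi.le (hj i hij).le (.inr (.inl ⟨hxi, ha₀⟩))⟩
  · exact ⟨i, fun k hk => eq_of k (hi k hk) (hj k hk),
      lt_of i hxi.le hyj.le (.inl ⟨hxi, hyj⟩)⟩
  · exact ⟨j, fun k hk => eq_of k (hi k (hk.trans hij)) (hj k hk),
      lt_of j (hi j hij).le hyj.le (.inr (.inr ⟨hyj, hb₀⟩))⟩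

theorem IsCompact.exists_toLex_le {d : ℕ} {K : Set (Fin d → ℝ)} (hK : IsCompact K)
    (hne : K.Nonempty) : ∃ x ∈ K, ∀ y ∈ K, toLex x ≤ toLex y := by
  -- Coordinates are minimized one at a time: `K'` holds the points optimal in the first `n`
  -- coordinates.
  have key : ∀ n ≤ d, ∃ K' ⊆ K, IsCompact K' ∧ K'.Nonempty ∧ ∀ x ∈ K', ∀ y ∈ K,
      toLex x ≤ toLex y ∨ (∀ i : Fin d, i.val < n → x i = y i) ∧ y ∈ K' := by
    intro n
    induction n with
    | zero => exact fun _ => ⟨K, Subset.rfl, hK, hne, fun x _ y hy => .inr ⟨by simp, hy⟩⟩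
    | succ n ih =>
      intro hn
      obtain ⟨K', hsub, hc, hne', h⟩ := ih (by omega)
      let k : Fin d := ⟨n, hn⟩
      obtain ⟨w, hw, hmin⟩ := hc.exists_isMinOn hne' (f := fun x : Fin d → ℝ => x k)
        (by fun_prop)
      refine ⟨K' ∩ {x | x k = w k}, inter_subset_left.trans hsub,
        hc.inter_right (isClosed_eq (by fun_prop) (by fun_prop)), ⟨w, hw, rfl⟩, ?_⟩
      rintro x ⟨hx, hxk⟩ y hy
      rcases h x hx y hy with hle | ⟨hagree, hyK⟩
      · exact .inl hle
      · have hwy : w k ≤ y k := hmin hyK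
        rw [← show x k = w k from hxk] at hwy
        rcases hwy.lt_or_eq with hlt | heq
        · exact .inl (le_of_lt ⟨k, fun j hj => hagree j hj, hlt⟩)
        · refine .inr ⟨fun i hi => ?_, hyK, heq.symm.trans hxk⟩
          rcases Nat.lt_succ_iff_lt_or_eq.1 hi with h₁ | h₁
          · exact hagree i h₁
          · rwa [show i = k from Fin.ext h₁]
  obtain ⟨K', hsub, -, ⟨x, hx⟩, h⟩ := key d le_rfl
  refine ⟨x, hsub hx, fun y hy => ?_⟩
  rcases h x hx y hy with hle | ⟨hagree, -⟩
  · exact hle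
  · rw [show x = y from funext fun i => hagree i i.2]

theorem exists_mem_convexHull_image_inter_compl {d : ℕ} {α : Type*} [Fintype α]
    (hα : d + 2 ≤ Fintype.card α) (x : α → Fin d → ℝ) :
    ∃ (I : Set α) (z : Fin d → ℝ), z ∈ convexHull ℝ (x '' I) ∧ z ∈ convexHull ℝ (x '' Iᶜ) := by
  have h : ¬ AffineIndependent ℝ x := fun h => by
    have h₁ := h.card_le_finrank_succ
    have h₂ := Submodule.finrank_le (vectorSpan ℝ (Set.range x))
    rw [Module.finrank_fin_fun] at h₂
    omega
  obtain ⟨I, z, hz⟩ := Convex.radon_partition h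
  exact ⟨I, z, hz⟩

theorem mem_of_mem_convexHull_image_inter_compl {E α β : Type*} [AddCommGroup E] [Module ℝ E]
    {x : α → E} {I : Set α} {z : E} (hI : z ∈ convexHull ℝ (x '' I))
    (hI' : z ∈ convexHull ℝ (x '' Iᶜ)) {e : α → β} (he : Function.Injective e) {C : Set E}
    (hC : Convex ℝ C) {j : β} (h : ∀ i, e i ≠ j → x i ∈ C) : z ∈ C := by
  by_cases hj : ∃ i ∈ I, e i = j
  · obtain ⟨i, hi, rfl⟩ := hj
    refine convexHull_min ?_ hC hI'
    rintro _ ⟨i', hi', rfl⟩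
    exact h i' fun h₁ => hi' (he h₁ ▸ hi)
  · push Not at hj
    refine convexHull_min ?_ hC hI
    rintro _ ⟨i', hi', rfl⟩
    exact h i' (hj i' hi')

/-- A point on a segment from an interior point of `K` to a point of `K` is interior, unless it is
the far endpoint. -/
theorem mem_convexHull_right_or_mem_interior {E : Type*} [AddCommGroup E] [Module ℝ E]
    [TopologicalSpace E] [IsTopologicalAddGroup E] [ContinuousConstSMul ℝ E] {s t : Set E} {z : E}
    (hz : z ∈ convexHull ℝ (s ∪ t)) :
    z ∈ convexHull ℝ t ∨ s.Nonempty ∧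
      ∀ K : Set E, Convex ℝ K → s ⊆ interior K → t ⊆ K → z ∈ interior K := by
  rcases s.eq_empty_or_nonempty with rfl | hs
  · exact .inl (by simpa using hz)
  rcases t.eq_empty_or_nonempty with rfl | ht
  · refine .inr ⟨hs, fun K hK hsK _ => convexHull_min hsK hK.interior (by simpa using hz)⟩
  rw [convexHull_union hs ht, mem_convexJoin] at hz
  obtain ⟨a, ha, b, hb, hab⟩ := hz
  by_cases hzb : z = b
  · exact .inl (hzb ▸ hb)
  refine .inr ⟨hs, fun K hK hsK htK => ?_⟩
  have ha' := convexHull_min hsK hK.interior ha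
  have hb' := convexHull_min htK hK hb
  by_cases hza : z = a
  · exact hza ▸ ha'
  · exact hK.openSegment_interior_self_subset_interior ha' hb'
      (mem_openSegment_of_ne_left_right (Ne.symm hza) (Ne.symm hzb) hab)

/-! ### Nested families and their extension to the bottom level -/

namespace NestedConvexFamily

variable {Y : Type*} [LinearOrder Y] {d : ℕ}

theorem monotone (κ : NestedConvexFamily Y d) : Monotone κ.toFun := fun a b hab => by
  rcases hab.lt_or_eq with h | rfl
  · exact κ.mono' a b h
  · exact Subset.rfl

/-- The family extended to the adjoined least level by the intersection of all its sets. -/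
def atLevel (κ : NestedConvexFamily Y d) (a : WithBot Y) : Set (Fin d → ℝ) :=
  ⋂ (l : Y) (_ : a ≤ l), κ.toFun l

theorem atLevel_coe (κ : NestedConvexFamily Y d) (l : Y) : κ.atLevel l = κ.toFun l := by
  refine Subset.antisymm (iInter₂_subset (s := fun (l' : Y) _ => κ.toFun l') l le_rfl)
    (subset_iInter₂ fun l' h => ?_)
  exact κ.monotone (WithBot.coe_le_coe.1 h)

theorem mem_atLevel_bot {κ : NestedConvexFamily Y d} {x : Fin d → ℝ} :
    x ∈ κ.atLevel ⊥ ↔ ∀ l, x ∈ κ.toFun l := by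
  simp [atLevel]

theorem convex_atLevel (κ : NestedConvexFamily Y d) (a : WithBot Y) : Convex ℝ (κ.atLevel a) :=
  convex_iInter₂ fun l _ => κ.convex' l

theorem isCompact_atLevel [Nonempty Y] (κ : NestedConvexFamily Y d) (a : WithBot Y) :
    IsCompact (κ.atLevel a) := by
  obtain ⟨l, hl⟩ : ∃ l : Y, a ≤ l := by
    induction a with
    | bot => exact ⟨Classical.arbitrary Y, bot_le⟩
    | coe l => exact ⟨l, le_rfl⟩
  exact (κ.isCompact' l).of_isClosed_subset
    (isClosed_iInter fun l => isClosed_iInter fun _ => (κ.isCompact' l).isClosed)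
    (iInter₂_subset l hl)

/-- The union of the sets below level `m` is dense in the interior of the `m`-th set, since
otherwise the level function is constantly `m` on an open set. A convex set with nonempty interior
has the same interior as its closure, so density becomes membership. -/
theorem IsContinuouslyShrinking.exists_lt_of_mem_interior {κ : NestedConvexFamily Y d}
    (hκ : κ.IsContinuouslyShrinking) {l m : Y} {z w : Fin d → ℝ} (hlm : l < m)
    (hw : w ∈ κ.toFun l) (hz : z ∈ interior (κ.toFun m)) : ∃ l' < m, z ∈ κ.toFun l' := by
  have hdense : interior (κ.toFun m) ⊆ closure (⋃ l' : Iio m, κ.toFun l') := by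
    intro y hy
    rw [mem_closure_iff]
    intro V hV hyV
    by_contra hempty
    refine hκ.1 ⟨V ∩ interior (κ.toFun m), m, hV.inter isOpen_interior, ⟨y, hyV, hy⟩, ?_⟩
    rintro x ⟨hxV, hxm⟩
    refine ⟨(interior_subset hxm : x ∈ κ.toFun m), fun l' hl' => ?_⟩
    by_contra hlt
    exact hempty ⟨x, hxV, mem_iUnion.2 ⟨⟨l', not_le.1 hlt⟩, hl'⟩⟩
  -- If `m` has an immediate predecessor, the union is a single closed set; otherwise a level
  -- strictly between `l` and `m` gives it nonempty interior.
  by_cases hmax : ∃ l₀ < m, ∀ l' < m, l' ≤ l₀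
  · obtain ⟨l₀, hl₀, hmax⟩ := hmax
    refine ⟨l₀, hl₀, ?_⟩
    refine closure_minimal ?_ (κ.isCompact' l₀).isClosed (hdense hz)
    exact iUnion_subset fun l' => κ.monotone (hmax l' l'.2)
  · push Not at hmax
    obtain ⟨l', hl'm, hll'⟩ := hmax l hlm
    have hconv : Convex ℝ (⋃ l' : Iio m, κ.toFun l') :=
      Directed.convex_iUnion (directed_of_isDirected_le fun a b hab => κ.monotone hab)
        fun l' => κ.convex' l'
    have hne : (interior (⋃ l' : Iio m, κ.toFun l')).Nonempty :=
      ⟨w, interior_mono (subset_iUnion (fun l' : Iio m => κ.toFun l') ⟨l', hl'm⟩)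
        (hκ.2 l l' hll' hw)⟩
    have hz' : z ∈ interior (closure (⋃ l' : Iio m, κ.toFun l')) :=
      interior_maximal hdense isOpen_interior hz
    rw [hconv.interior_closure_eq_interior_of_nonempty_interior hne] at hz'
    obtain ⟨l'', h⟩ := mem_iUnion.1 (interior_subset hz')
    exact ⟨l'', l''.2, h⟩

end NestedConvexFamily

/-! ### Feasible pairs and existence of optima -/

namespace QuasiconvexProgram

variable {Y : Type*} [LinearOrder Y] {d : ℕ} {ι : Type*}

theorem toLex_mem_feasible {κ : ι → NestedConvexFamily Y d} {T : Finset ι} {a : WithBot Y}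
    {x : Fin d → ℝ} : toLex (a, toLex x) ∈ feasible κ T ↔
      (a = ⊥ → NoMinOrder Y) ∧ ∀ i ∈ T, x ∈ (κ i).atLevel a := by
  induction a with
  | bot =>
    simp [feasible, NestedConvexFamily.mem_atLevel_bot]
  | coe l =>
    simp [feasible, NestedConvexFamily.atLevel_coe]

omit [LinearOrder Y] in
theorem exists_eq_toLex (p : Pairs Y d) : ∃ a x, p = toLex (a, toLex x) := ⟨_, _, rfl⟩

theorem feasible_anti (κ : ι → NestedConvexFamily Y d) {A B : Finset ι} (h : A ⊆ B) :
    feasible κ B ⊆ feasible κ A := by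
  intro p hp
  obtain ⟨a, x, rfl⟩ := exists_eq_toLex p
  rw [toLex_mem_feasible] at hp ⊢
  exact ⟨hp.1, fun i hi => hp.2 i (h hi)⟩

theorem exists_level_of_lt {κ : ι → NestedConvexFamily Y d} {T : Finset ι} {a b : WithBot Y}
    {x : Fin d → ℝ} (h : toLex (b, toLex x) ∈ feasible κ T) (hba : b < a) :
    ∃ l : Y, (l : WithBot Y) < a ∧ ∀ i ∈ T, x ∈ (κ i).toFun l := by
  rw [toLex_mem_feasible] at h
  induction b with
  | bot =>
    have := h.1 rfl
    obtain ⟨m, rfl⟩ := WithBot.ne_bot_iff_exists.1 hba.ne'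
    obtain ⟨l, hl⟩ := exists_lt m
    exact ⟨l, WithBot.coe_lt_coe.2 hl, fun i hi => NestedConvexFamily.mem_atLevel_bot.1 (h.2 i hi) l⟩
  | coe l => exact ⟨l, hba, fun i hi => NestedConvexFamily.atLevel_coe (κ i) l ▸ h.2 i hi⟩

theorem isUpperSet_levels (κ : ι → NestedConvexFamily Y d) (T : Finset ι) :
    IsUpperSet (levels κ T) := fun _ _ hab ⟨x, hx⟩ =>
  ⟨x, fun i hi => (κ i).monotone hab (hx i hi)⟩

theorem nonempty_iInter_of_levels {κ : ι → NestedConvexFamily Y d} {T : Finset ι}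
    (hT : T.Nonempty) {P : Set Y} (hP : P.Nonempty) (h : P ⊆ levels κ T) :
    ∃ x, ∀ i ∈ T, ∀ l ∈ P, x ∈ (κ i).toFun l := by
  obtain ⟨i₀, hi₀⟩ := hT
  have := hP.to_subtype
  have hclosed : ∀ l : Y, IsClosed (⋂ i ∈ T, (κ i).toFun l) := fun l =>
    isClosed_biInter fun i _ => ((κ i).isCompact' l).isClosed
  obtain ⟨x, hx⟩ := IsCompact.nonempty_iInter_of_directed_nonempty_isCompact_isClosed
    (fun l : P => ⋂ i ∈ T, (κ i).toFun l)
    (directed_of_isDirected_ge fun a b hab => iInter₂_mono fun i _ => (κ i).monotone hab)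
    (fun l => by
      obtain ⟨x, hx⟩ := h l.2
      exact ⟨x, mem_iInter₂.2 hx⟩)
    (fun l => ((κ i₀).isCompact' l).of_isClosed_subset (hclosed l) (iInter₂_subset i₀ hi₀))
    (fun l => hclosed l)
  exact ⟨x, fun i hi l hl => mem_iInter₂.1 (mem_iInter.1 hx ⟨l, hl⟩) i hi⟩

theorem exists_isLeast_feasible_of_level [Nonempty Y] {κ : ι → NestedConvexFamily Y d}
    {T : Finset ι} (hT : T.Nonempty) {a : WithBot Y} {x : Fin d → ℝ}
    (hx : toLex (a, toLex x) ∈ feasible κ T)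
    (hlow : ∀ l ∈ levels κ T, a ≤ l) : ∃ p, IsLeast (feasible κ T) p := by
  obtain ⟨i₀, hi₀⟩ := hT
  have hx' := toLex_mem_feasible.1 hx
  have hc : IsCompact (⋂ i ∈ T, (κ i).atLevel a) :=
    ((κ i₀).isCompact_atLevel a).of_isClosed_subset
      (isClosed_biInter fun i _ => ((κ i).isCompact_atLevel a).isClosed) (iInter₂_subset i₀ hi₀)
  obtain ⟨w, hw, hmin⟩ := hc.exists_toLex_le ⟨x, mem_iInter₂.2 hx'.2⟩
  refine ⟨toLex (a, toLex w), toLex_mem_feasible.2 ⟨hx'.1, mem_iInter₂.1 hw⟩, fun q hq => ?_⟩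
  obtain ⟨b, y, rfl⟩ := exists_eq_toLex q
  rw [Prod.Lex.toLex_le_toLex]
  rcases lt_trichotomy a b with h | rfl | h
  · exact .inl h
  · exact .inr ⟨rfl, hmin y (mem_iInter₂.2 (toLex_mem_feasible.1 hq).2)⟩
  · obtain ⟨l, hl, hy⟩ := exists_level_of_lt hq h
    exact absurd (hlow l ⟨y, hy⟩) hl.not_ge

theorem exists_isLeast_feasible [Nonempty Y] {κ : ι → NestedConvexFamily Y d} {T : Finset ι}
    (hinf : (levels κ T).Nonempty → BddBelow (levels κ T) → ∃ m, IsGLB (levels κ T) m)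
    (hT : T.Nonempty) (hne : (feasible κ T).Nonempty) : ∃ p, IsLeast (feasible κ T) p := by
  have hlev : (levels κ T).Nonempty := by
    obtain ⟨p, hp⟩ := hne
    obtain ⟨a, x, rfl⟩ := exists_eq_toLex p
    rw [toLex_mem_feasible] at hp
    induction a with
    | bot => exact ⟨Classical.arbitrary Y, x,
        fun i hi => NestedConvexFamily.mem_atLevel_bot.1 (hp.2 i hi) _⟩
    | coe l => exact ⟨l, x, fun i hi => (κ i).atLevel_coe l ▸ hp.2 i hi⟩
  by_cases hb : BddBelow (levels κ T)
  · obtain ⟨m, hm⟩ := hinf hlev hb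
    have hmem : m ∈ levels κ T := by
      -- An unattained infimum makes the levels exactly `Ioi m`; compactness gives a point common to
      -- all of them, and continuity from above puts it at level `m`.
      by_contra hnot
      have hIoi : levels κ T = Ioi m := by
        refine Subset.antisymm (fun l hl => (hm.1 hl).lt_of_ne fun h => hnot (h ▸ hl)) ?_
        intro l hl
        obtain ⟨l', hl', hlt⟩ := (isGLB_lt_iff hm).1 hl
        exact isUpperSet_levels κ T hlt.le hl'
      rw [hIoi] at hm hlev
      obtain ⟨x, hx⟩ := nonempty_iInter_of_levels hT hlev hIoi.ge
      refine hnot ⟨x, fun i hi => ?_⟩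
      rw [(κ i).inter' m hlev hm]
      exact mem_iInter₂.2 (hx i hi)
    obtain ⟨x, hx⟩ := hmem
    exact exists_isLeast_feasible_of_level hT (a := m) (x := x)
      (toLex_mem_feasible.2 ⟨by simp, fun i hi => ((κ i).atLevel_coe m).symm ▸ hx i hi⟩)
      fun l hl => WithBot.coe_le_coe.2 (hm.1 hl)
  · have huniv : ∀ l, l ∈ levels κ T := fun l => by
      obtain ⟨l', hl', hlt⟩ := not_bddBelow_iff.1 hb l
      exact isUpperSet_levels κ T hlt.le hl'
    have hmin : NoMinOrder Y := ⟨fun l => by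
      obtain ⟨l', -, hlt⟩ := not_bddBelow_iff.1 hb l
      exact ⟨l', hlt⟩⟩
    obtain ⟨x, hx⟩ := nonempty_iInter_of_levels (P := univ) hT univ_nonempty fun l _ => huniv l
    exact exists_isLeast_feasible_of_level hT (a := ⊥) (x := x)
      (toLex_mem_feasible.2 ⟨fun _ => hmin, fun i hi =>
        NestedConvexFamily.mem_atLevel_bot.2 fun l => hx i hi l trivial⟩)
      fun l _ => bot_le

theorem value_eq_coe {κ : ι → NestedConvexFamily Y d} {T : Finset ι} {p : Pairs Y d}
    (hp : IsLeast (feasible κ T) p) : value κ T = ((p : WithTop (Pairs Y d)) : WithBot _) := by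
  have h : ∃ p, IsLeast (feasible κ T) p := ⟨p, hp⟩
  rw [value, dif_pos h, h.choose_spec.unique hp]

theorem value_eq_top {κ : ι → NestedConvexFamily Y d} {T : Finset ι}
    (h : ¬ (feasible κ T).Nonempty) :
    value κ T = ((⊤ : WithTop (Pairs Y d)) : WithBot (WithTop (Pairs Y d))) := by
  rw [value, dif_neg fun ⟨p, hp⟩ => h ⟨p, hp.1⟩, if_neg h]

theorem value_eq_bot {κ : ι → NestedConvexFamily Y d} {T : Finset ι}
    (h : (feasible κ T).Nonempty) (h' : ¬ ∃ p, IsLeast (feasible κ T) p) : value κ T = ⊥ := by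
  rw [value, dif_neg h', if_pos h]

/-! ### Monotonicity and locality -/

theorem isLPType_value [DecidableEq ι] {κ : ι → NestedConvexFamily Y d}
    (hleast : ∀ T : Finset ι, T.Nonempty → (feasible κ T).Nonempty →
      ∃ p, IsLeast (feasible κ T) p) : IsLPType (value κ) where
  mono A B hAB := by
    by_cases hB : (feasible κ B).Nonempty
    · have hA := hB.mono (feasible_anti κ hAB)
      by_cases hA' : ∃ p, IsLeast (feasible κ A) p
      · by_cases hB' : ∃ p, IsLeast (feasible κ B) p
        · obtain ⟨p, hp⟩ := hA'
          obtain ⟨q, hq⟩ := hB'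
          rw [value_eq_coe hp, value_eq_coe hq, WithBot.coe_le_coe, WithTop.coe_le_coe]
          exact hp.2 (feasible_anti κ hAB hq.1)
        · have hBe : B = ∅ := Finset.not_nonempty_iff_eq_empty.1 fun h => hB' (hleast B h hB)
          rw [hBe, Finset.subset_empty] at hAB
          rw [hAB, hBe]
      · rw [value_eq_bot hA hA']
        exact bot_le
    · rw [value_eq_top hB]
      exact WithBot.le_coe_iff.2 fun a _ => le_top
  locality A p q hp hq := by
    have hpq : A ∪ {p, q} = (A ∪ {p}) ∪ (A ∪ {q}) := by
      ext; simp only [Finset.mem_union, Finset.mem_insert, Finset.mem_singleton]; tauto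
    have hinter : feasible κ (A ∪ {p, q}) = feasible κ (A ∪ {p}) ∩ feasible κ (A ∪ {q}) := by
      refine Subset.antisymm (subset_inter (feasible_anti κ ?_) (feasible_anti κ ?_)) ?_
      · exact hpq ▸ Finset.subset_union_left
      · exact hpq ▸ Finset.subset_union_right
      · rintro r ⟨h₁, h₂⟩
        obtain ⟨a, x, rfl⟩ := exists_eq_toLex r
        rw [toLex_mem_feasible] at h₁ h₂ ⊢
        refine ⟨h₁.1, fun i hi => ?_⟩
        rw [hpq, Finset.mem_union] at hi
        exact hi.elim (h₁.2 i) (h₂.2 i)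
    -- Even for empty `A` these unions are nonempty, so equal values come from equal optima or from
    -- infeasibility, never from `⊥`.
    have hP : ∀ r : ι, (A ∪ {r}).Nonempty := fun r => ⟨r, by simp⟩
    by_cases hfp : (feasible κ (A ∪ {p})).Nonempty
    · obtain ⟨r, hr⟩ := hleast _ (hP p) hfp
      have hv := value_eq_coe hr
      by_cases hfq : (feasible κ (A ∪ {q})).Nonempty
      · obtain ⟨s, hs⟩ := hleast _ (hP q) hfq
        have hvs := value_eq_coe hs
        obtain rfl : r = s := by
          rw [← hp, hq, hvs, WithBot.coe_inj, WithTop.coe_inj] at hv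
          exact hv.symm
        rw [hp, hv, value_eq_coe (p := r)]
        rw [hinter]
        exact ⟨⟨hr.1, hs.1⟩, fun t ht => hr.2 ht.1⟩
      · rw [hq, value_eq_top hfq, value_eq_top]
        rw [hinter]
        exact fun h => hfq (h.mono inter_subset_right)
    · rw [hp, value_eq_top hfp, value_eq_top]
      rw [hinter]
      exact fun h => hfp (h.mono inter_subset_left)

/-! ### Dimension bounds -/

theorem exists_common_level [Nonempty Y] {P : Y → Prop}
    {s : Finset ι} (hs : s.Nonempty) {Q : ι → Y → Prop} (hQ : ∀ i ∈ s, Monotone (Q i))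
    (h : ∀ i ∈ s, ∃ l, P l ∧ Q i l) : ∃ l, P l ∧ ∀ i ∈ s, Q i l := by
  choose! f hP hf using h
  obtain ⟨m, hm, hmax⟩ := s.exists_max_image f hs
  exact ⟨f m, hP m hm, fun i hi => hQ i hi (hmax i hi) (hf i hi)⟩

theorem card_le_of_levels [Nonempty Y] {κ : ι → NestedConvexFamily Y d} {B L : Finset ι}
    {P : Y → Prop} (x : ι → Fin d → ℝ)
    (hx : ∀ i ∈ L, ∃ l, P l ∧ ∀ j ∈ B, j ≠ i → x i ∈ (κ j).toFun l)
    (hB : ∀ l, P l → ∀ z, ¬ ∀ j ∈ B, z ∈ (κ j).toFun l) : L.card ≤ d + 1 := by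
  by_contra! hcard
  obtain ⟨l, hl, hxl⟩ := exists_common_level (Finset.card_pos.1 (by omega : 0 < L.card))
    (Q := fun i l => ∀ j ∈ B, j ≠ i → x i ∈ (κ j).toFun l)
    (fun i _ a b hab h j hj hji => (κ j).monotone hab (h j hj hji)) hx
  obtain ⟨I, z, hz, hz'⟩ := exists_mem_convexHull_image_inter_compl (d := d) (α := L)
    (by rwa [Fintype.card_coe]) (fun i => x i)
  exact hB l hl z fun j hj => mem_of_mem_convexHull_image_inter_compl hz hz'
    Subtype.val_injective ((κ j).convex' l) fun i hi => hxl i i.2 j hj hi.symm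

theorem card_le_of_toLex_lt {C : ι → Set (Fin d → ℝ)} (hC : ∀ i, Convex ℝ (C i))
    {B N : Finset ι} (x : ι → Fin d → ℝ) (c : Fin d → ℝ) (hc : ∀ j ∈ B, c ∈ C j)
    (hx : ∀ i ∈ N, toLex (x i) < toLex c ∧ ∀ j ∈ B, j ≠ i → x i ∈ C j)
    (hB : ∀ z, (∀ j ∈ B, z ∈ C j) → ¬ toLex z < toLex c) : N.card ≤ d := by
  by_contra! hcard
  -- The index `none` carries `c`; the part avoiding it consists of points below `c`, so `z` is
  -- below `c` too.
  obtain ⟨I, z, hz, hz'⟩ := exists_mem_convexHull_image_inter_compl (d := d) (α := Option N)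
    (by simpa using hcard) (fun i => i.elim c fun i => x i)
  have hlt : ∀ J : Set (Option N), none ∉ J →
      z ∈ convexHull ℝ ((fun i : Option N => i.elim c fun i => x i) '' J) →
      toLex z < toLex c := by
    refine fun J hJ hzJ => convexHull_min ?_ (convex_setOf_toLex_lt c) hzJ
    rintro _ ⟨_ | i, hi, rfl⟩
    · exact absurd hi hJ
    · exact (hx i i.2).1
  refine hB z (fun j hj => ?_) ?_
  · refine mem_of_mem_convexHull_image_inter_compl hz hz'
      (Option.map_injective Subtype.val_injective) (hC j) (j := some j) ?_
    rintro (_ | i) hi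
    · exact hc j hj
    · exact (hx i i.2).2 j hj fun h => hi (by simp [h])
  · by_cases hI : none ∈ I
    · exact hlt Iᶜ (fun h => h hI) hz'
    · exact hlt I hI hz

theorem card_le_of_constant_or_shrinking [Nonempty Y] {κ : ι → NestedConvexFamily Y d}
    (hκ : ∀ i, (κ i).IsConstant ∨ (κ i).IsContinuouslyShrinking) {B : Finset ι} {m : Y}
    (x : ι → Fin d → ℝ) (c : Fin d → ℝ)
    (hx : ∀ i ∈ B, (∃ l < m, ∀ j ∈ B, j ≠ i → x i ∈ (κ j).toFun l) ∨
      toLex (x i) < toLex c ∧ ∀ j ∈ B, j ≠ i → x i ∈ (κ j).toFun m)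
    (hlow : ∀ l < m, ∀ z, ¬ ∀ j ∈ B, z ∈ (κ j).toFun l)
    (hB : ∀ z, (∀ j ∈ B, z ∈ (κ j).toFun m) → ¬ toLex z < toLex c) : B.card ≤ d + 1 := by
  by_contra! hcard
  have hmem : ∀ i ∈ B, ∀ j ∈ B, j ≠ i → x i ∈ (κ j).toFun m := by
    intro i hi j hj hji
    rcases hx i hi with ⟨l, hl, h⟩ | h
    · exact (κ j).monotone hl.le (h j hj hji)
    · exact h.2 j hj hji
  obtain ⟨I, z, hz, hz'⟩ := exists_mem_convexHull_image_inter_compl (d := d) (α := B)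
    (by rwa [Fintype.card_coe]) (fun i => x i)
  have hzm : ∀ j ∈ B, z ∈ (κ j).toFun m := fun j hj =>
    mem_of_mem_convexHull_image_inter_compl hz hz' Subtype.val_injective ((κ j).convex' m)
      fun i hi => hmem i i.2 j hj hi.symm
  let A : Set B := {i | ∃ l < m, ∀ j ∈ B, j ≠ i → x i ∈ (κ j).toFun l}
  -- Take the part without `j`. Were `z` in the hull of its points outside `A`, it would be feasible
  -- at `m` and below `c`; so points of `A` contribute and make `z` interior when family `j` is
  -- shrinking.
  have key : ∀ J : Set B, z ∈ convexHull ℝ ((fun i : B => x i) '' J) → ∀ j : B, j ∉ J →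
      ∃ l < m, z ∈ (κ j).toFun l := by
    intro J hzJ j hj
    have hne : ∀ i ∈ J, (j : ι) ≠ i := fun i hi h => hj (Subtype.ext h ▸ hi)
    rw [← inter_union_sdiff J A, image_union] at hzJ
    rcases mem_convexHull_right_or_mem_interior hzJ with h | ⟨⟨_, i, ⟨hiJ, l, hl, hil⟩, rfl⟩, hint⟩
    · refine absurd (convexHull_min ?_ (convex_setOf_toLex_lt c) h) (hB z hzm)
      rintro _ ⟨i, ⟨-, hi⟩, rfl⟩
      exact ((hx i i.2).resolve_left hi).1
    · have hij := hil j j.2 (hne i hiJ)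
      rcases hκ j with hj' | hj'
      · exact ⟨l, hl, hj' m l ▸ hzm j j.2⟩
      · refine hj'.exists_lt_of_mem_interior hl hij (hint _ ((κ j).convex' m) ?_ ?_)
        · rintro _ ⟨i', ⟨hi', l', hl', h'⟩, rfl⟩
          exact hj'.2 l' m hl' (h' j j.2 (hne i' hi'))
        · rintro _ ⟨i', ⟨hi', -⟩, rfl⟩
          exact hmem i' i'.2 j j.2 (hne i' hi')
  have hall : ∀ j ∈ B, ∃ l, l < m ∧ z ∈ (κ j).toFun l := by
    intro j hj
    by_cases hjI : (⟨j, hj⟩ : B) ∈ I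
    · exact key Iᶜ hz' ⟨j, hj⟩ fun h => h hjI
    · exact key I hz ⟨j, hj⟩ hjI
  obtain ⟨l, hl, h⟩ := exists_common_level (Finset.card_pos.1 (by omega : 0 < B.card))
    (fun i _ a b hab h => (κ i).monotone hab h) hall
  exact hlow l hl z h

theorem exists_points_of_isLPBasis [DecidableEq ι] {κ : ι → NestedConvexFamily Y d}
    (hleast : ∀ T : Finset ι, T.Nonempty → (feasible κ T).Nonempty →
      ∃ p, IsLeast (feasible κ T) p) {B : Finset ι} (hB : IsLPBasis (value κ) B)
    (hcard : 2 ≤ B.card) : ∃ (b : ι → WithBot Y) (x : ι → Fin d → ℝ), ∀ i ∈ B,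
      toLex (b i, toLex (x i)) ∈ feasible κ (B.erase i) ∧
      ∀ p, IsLeast (feasible κ B) p → toLex (b i, toLex (x i)) < p := by
  have h : ∀ i ∈ B, ∃ (b : WithBot Y) (x : Fin d → ℝ),
      toLex (b, toLex x) ∈ feasible κ (B.erase i) ∧
      ∀ p, IsLeast (feasible κ B) p → toLex (b, toLex x) < p := by
    intro i hi
    have hlt := hB _ (Finset.erase_ssubset hi)
    have hne : (B.erase i).Nonempty := by
      rw [← Finset.card_pos, Finset.card_erase_of_mem hi]; omega
    have hf : (feasible κ (B.erase i)).Nonempty := by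
      by_contra hf
      rw [value_eq_top hf] at hlt
      exact absurd hlt (not_lt.2 (WithBot.le_coe_iff.2 fun a _ => le_top))
    obtain ⟨q, hq⟩ := hleast _ hne hf
    obtain ⟨b, x, rfl⟩ := exists_eq_toLex q
    refine ⟨b, x, hq.1, fun p hp => ?_⟩
    rwa [value_eq_coe hq, value_eq_coe hp, WithBot.coe_lt_coe, WithTop.coe_lt_coe] at hlt
  choose! b x h using h
  exact ⟨b, x, h⟩

theorem card_le_or_exists_of_isLPBasis [Nonempty Y] [DecidableEq ι]
    {κ : ι → NestedConvexFamily Y d}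
    (hleast : ∀ T : Finset ι, T.Nonempty → (feasible κ T).Nonempty →
      ∃ p, IsLeast (feasible κ T) p) {B : Finset ι} (hB : IsLPBasis (value κ) B) :
    B.card ≤ d + 1 ∨ ∃ (a : WithBot Y) (c : Fin d → ℝ) (x : ι → Fin d → ℝ),
      (∀ j ∈ B, c ∈ (κ j).atLevel a) ∧
      (∀ i ∈ B, (∃ l : Y, (l : WithBot Y) < a ∧ ∀ j ∈ B, j ≠ i → x i ∈ (κ j).toFun l) ∨
        toLex (x i) < toLex c ∧ ∀ j ∈ B, j ≠ i → x i ∈ (κ j).atLevel a) ∧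
      (∀ l : Y, (l : WithBot Y) < a → ∀ z, ¬ ∀ j ∈ B, z ∈ (κ j).toFun l) ∧
      ∀ z, (∀ j ∈ B, z ∈ (κ j).atLevel a) → ¬ toLex z < toLex c := by
  -- Singletons are set aside because erasing their element leaves the empty program, which may have
  -- no optimum.
  rcases le_or_gt B.card 1 with hcard | hcard
  · exact .inl (by omega)
  obtain ⟨b, x, hx⟩ := exists_points_of_isLPBasis hleast hB hcard
  by_cases hf : (feasible κ B).Nonempty
  · obtain ⟨p, hp⟩ := hleast B (Finset.card_pos.1 (by omega)) hf
    obtain ⟨a, c, rfl⟩ := exists_eq_toLex p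
    have hac := toLex_mem_feasible.1 hp.1
    refine .inr ⟨a, c, x, hac.2, fun i hi => ?_, fun l hl z hz => ?_, fun z hz hlt => ?_⟩
    · obtain ⟨hxf, hlt⟩ := hx i hi
      rcases Prod.Lex.toLex_lt_toLex.1 (hlt _ hp) with h | ⟨h, h'⟩
      · obtain ⟨l, hl, hxl⟩ := exists_level_of_lt hxf h
        exact .inl ⟨l, hl, fun j hj hji => hxl j (Finset.mem_erase.2 ⟨hji, hj⟩)⟩
      · obtain rfl : b i = a := h
        exact .inr ⟨h', fun j hj hji =>
          (toLex_mem_feasible.1 hxf).2 j (Finset.mem_erase.2 ⟨hji, hj⟩)⟩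
    · have hmem : toLex ((l : WithBot Y), toLex z) ∈ feasible κ B :=
        toLex_mem_feasible.2 ⟨by simp, fun j hj => ((κ j).atLevel_coe l).symm ▸ hz j hj⟩
      exact (hp.2 hmem).not_gt (Prod.Lex.toLex_lt_toLex.2 (.inl hl))
    · have hmem : toLex (a, toLex z) ∈ feasible κ B := toLex_mem_feasible.2 ⟨hac.1, hz⟩
      exact (hp.2 hmem).not_gt (Prod.Lex.toLex_lt_toLex.2 (.inr ⟨rfl, hlt⟩))
  · refine .inl (card_le_of_levels (κ := κ) (B := B) (P := fun _ => True) x ?_ ?_)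
    · intro i hi
      obtain ⟨hxf, -⟩ := hx i hi
      rw [toLex_mem_feasible] at hxf
      obtain ⟨l, hl⟩ : ∃ l : Y, b i ≤ l := by
        induction b i with
        | bot => exact ⟨Classical.arbitrary Y, bot_le⟩
        | coe l => exact ⟨l, le_rfl⟩
      exact ⟨l, trivial, fun j hj hji =>
        mem_iInter₂.1 (hxf.2 j (Finset.mem_erase.2 ⟨hji, hj⟩)) l hl⟩
    · intro l _ z hz
      exact hf ⟨_, toLex_mem_feasible.2 ⟨by simp, fun j hj =>
        ((κ j).atLevel_coe l).symm ▸ hz j hj⟩⟩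

theorem lpDimensionLE_value [Nonempty Y] [DecidableEq ι] {κ : ι → NestedConvexFamily Y d}
    (hleast : ∀ T : Finset ι, T.Nonempty → (feasible κ T).Nonempty →
      ∃ p, IsLeast (feasible κ T) p) : LPDimensionLE (value κ) (2 * d + 1) := by
  intro B hB
  rcases card_le_or_exists_of_isLPBasis hleast hB with h | ⟨a, c, x, hc, hx, hlow, hmin⟩
  · omega
  classical
  have h₁ := card_le_of_levels (κ := κ) (B := B)
    (L := B.filter fun i => ∃ l : Y, (l : WithBot Y) < a ∧ ∀ j ∈ B, j ≠ i → x i ∈ (κ j).toFun l)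
    (P := fun l => (l : WithBot Y) < a) x (fun i hi => (Finset.mem_filter.1 hi).2) hlow
  have h₂ := card_le_of_toLex_lt (fun j => (κ j).convex_atLevel a) (B := B)
    (N := B.filter fun i =>
      ¬ ∃ l : Y, (l : WithBot Y) < a ∧ ∀ j ∈ B, j ≠ i → x i ∈ (κ j).toFun l) x c hc
    (fun i hi => (hx i (Finset.mem_filter.1 hi).1).resolve_left (Finset.mem_filter.1 hi).2) hmin
  rw [← Finset.card_filter_add_card_filter_not (s := B)
    fun i => ∃ l : Y, (l : WithBot Y) < a ∧ ∀ j ∈ B, j ≠ i → x i ∈ (κ j).toFun l]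
  omega

theorem lpDimensionLE_value_of_constant_or_shrinking [Nonempty Y] [DecidableEq ι]
    {κ : ι → NestedConvexFamily Y d}
    (hleast : ∀ T : Finset ι, T.Nonempty → (feasible κ T).Nonempty →
      ∃ p, IsLeast (feasible κ T) p)
    (hκ : ∀ i, (κ i).IsConstant ∨ (κ i).IsContinuouslyShrinking) :
    LPDimensionLE (value κ) (d + 1) := by
  intro B hB
  rcases card_le_or_exists_of_isLPBasis hleast hB with h | ⟨a, c, x, hc, hx, hlow, hmin⟩
  · exact h
  induction a with
  | bot =>
    -- No level lies below `⊥`, so every point is of the lexicographic kind.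
    have := card_le_of_toLex_lt (fun j => (κ j).convex_atLevel ⊥) (N := B) x c hc
      (fun i hi => (hx i hi).resolve_left (by simp)) hmin
    omega
  | coe m =>
    simp only [WithBot.coe_lt_coe, NestedConvexFamily.atLevel_coe] at hx hlow hmin
    exact card_le_of_constant_or_shrinking hκ x c hx hlow hmin

end QuasiconvexProgram

theorem theorem4 {Y : Type*} [LinearOrder Y] [Nonempty Y] {d : ℕ}
    {ι : Type*} [Fintype ι] [DecidableEq ι] (κ : ι → NestedConvexFamily Y d)
    (hinf : ∀ T : Finset ι, T.Nonempty → (QuasiconvexProgram.levels κ T).Nonempty →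
      BddBelow (QuasiconvexProgram.levels κ T) →
      ∃ m, IsGLB (QuasiconvexProgram.levels κ T) m) :
    (∀ T : Finset ι, T.Nonempty → (QuasiconvexProgram.feasible κ T).Nonempty →
      ∃ p, IsLeast (QuasiconvexProgram.feasible κ T) p ∧
        QuasiconvexProgram.value κ T = ((p : WithTop (QuasiconvexProgram.Pairs Y d)) :
          WithBot (WithTop (QuasiconvexProgram.Pairs Y d)))) ∧
    IsLPType (QuasiconvexProgram.value κ) ∧
    LPDimensionLE (QuasiconvexProgram.value κ) (2 * d + 1) ∧
    ((∀ i, (κ i).IsConstant ∨ (κ i).IsContinuouslyShrinking) →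
      LPDimensionLE (QuasiconvexProgram.value κ) (d + 1)) := by
  have hleast : ∀ T : Finset ι, T.Nonempty → (QuasiconvexProgram.feasible κ T).Nonempty →
      ∃ p, IsLeast (QuasiconvexProgram.feasible κ T) p := fun T hT =>
    QuasiconvexProgram.exists_isLeast_feasible (hinf T hT) hT
  refine ⟨fun T hT hne => ?_, QuasiconvexProgram.isLPType_value hleast,
    QuasiconvexProgram.lpDimensionLE_value hleast,
    QuasiconvexProgram.lpDimensionLE_value_of_constant_or_shrinking hleast⟩
  obtain ⟨p, hp⟩ := hleast T hT hne
  exact ⟨p, hp, QuasiconvexProgram.value_eq_coe hp⟩
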